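/- A \emph{group pair} $(G,\mathcal{P})$ consists of a finitely generated group $G$ and a non-empty finite collection $\mathcal{P}$ of subgroups of $G$ (repetitions are allowed). Write $G/\mathcal{P}=\coprod_{P\in\mathcal{P}}G/P$, whose elements are also viewed as left cosets, i.e. as subsets of $G$. A group pair $(G,\mathcal{P})$ is \emph{relatively finitely presented} if there are a finite subset $S\subset G$ and a finite subset $R$ of the free product $F=F(S)*\mathop{\ast}_{P\in\mathcal{P}}P$ (where $F(S)$ is the free group on $S$) such that the homomorphism $\varphi\colon F\to G$ induced by the inclusions $S\subset G$ and $P\subset G$ is surjective and $\ker(\varphi)$ is the normal closure of $R$ in $F$. Let $(G,\mathcal{P})$ and $(H,\mathcal{Q})$ be group pairs, and equip $G$ and $H$ with word metrics $d_G$, $d_H$ associated to some finite generating sets. For real numbers $L\ge 1$, $C\ge 0$, $M\ge 0$, an \emph{$(L,C,M)$-Lipschitz map of pairs} $f=(f_1,f_2)\colon(G,\mathcal{P})\to(H,\mathcal{Q})$ consists of functions $f_1\colon G\to H$ and $f_2\colon G/\mathcal{P}\to H/\mathcal{Q}$ such that $d_H(f_1(x),f_1(y))\le L\,d_G(x,y)+C$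 for all $x,y\in G$, and the Hausdorff distance in $H$ between $f_1(A)$ and $f_2(A)$ is $<M$ for all $A\in G/\mathcal{P}$. The group pair $(G,\mathcal{P})$ is a \emph{quasi-retract} of $(H,\mathcal{Q})$ if for some such $L,C,M$ there are $(L,C,M)$-Lipschitz maps of pairs $f\colon(G,\mathcal{P})\to(H,\mathcal{Q})$ and $r\colon(H,\mathcal{Q})\to(G,\mathcal{P})$ with $d_G(r_1(f_1(g)),g)\le C$ for all $g\in G$ and $r_2\circ f_2=\mathrm{id}_{G/\mathcal{P}}$. \textbf{Theorem.} Let $(G,\mathcal{P})$ and $(H,\mathcal{Q})$ be group pairs. If $(G,\mathcal{P})$ is a quasi-retract of $(H,\mathcal{Q})$ and $(H,\mathcal{Q})$ is relatively finitely presented, then $(G,\mathcal{P})$ is relatively finitely presented. -/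

import Mathlib

/-! A group pair `(G, 𝒫)` is given by a finitely generated group `G` and a non-empty finite
family `P : ι → Subgroup G` (repetitions are allowed). Finite generation of `G` and finiteness and
non-emptiness of `ι` are hypotheses of the theorem. -/

namespace GroupPair

section RelativePresentation

universe u w

variable {G : Type u} [Group G] {ι : Type w}

/-- The free product `F = F(S) * (∗_{i} P i)`. -/
abbrev RelFree (P : ι → Subgroup G) (S : Set G) : Type (max u w) :=
  Monoid.Coprod (FreeGroup S) (Monoid.CoprodI fun i => P i)

/-- The homomorphism `φ : F(S) * (∗_{i} P i) → G` induced by the inclusions of `S` and `P i`. -/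
def relHom (P : ι → Subgroup G) (S : Set G) : RelFree P S →* G :=
  Monoid.Coprod.lift (FreeGroup.lift (fun s : S => (s : G)))
    (Monoid.CoprodI.lift fun i => (P i).subtype)

/-- `S` is a relative generating set of `(G, P)`. -/
def IsRelGeneratingSet (P : ι → Subgroup G) (S : Set G) : Prop :=
  Function.Surjective (relHom P S)

/-- `⟨S, P ∣ R⟩` is a relative presentation of `(G, P)`: `S` is a relative generating set and the
normal closure of `R` in `F` is the kernel of `φ`. -/
structure IsRelPresentation (P : ι → Subgroup G) (S : Set G) (R : Set (RelFree P S)) : Prop where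
  generates : IsRelGeneratingSet P S
  normalClosure_eq : Subgroup.normalClosure R = (relHom P S).ker

/-- `(G, P)` is relatively finitely presented: there is a finite relative presentation. -/
def IsRelFinitelyPresented (P : ι → Subgroup G) : Prop :=
  ∃ (S : Set G) (R : Set (RelFree P S)), S.Finite ∧ R.Finite ∧ IsRelPresentation P S R

end RelativePresentation

section Cosets

variable {G : Type*} [Group G] {ι : Type*}

/-- The disjoint union `G/P = ∐ i, G/(P i)` of the sets of left cosets. -/
abbrev Cosets (P : ι → Subgroup G) : Type _ := Σ i, G ⧸ P i

/-- An element `(i, g (P i))` of `G/P`, viewed as the subset `g (P i)` of `G`. -/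
def Cosets.toSet {P : ι → Subgroup G} (A : Cosets P) : Set G :=
  {g | (QuotientGroup.mk g : G ⧸ P A.1) = A.2}

end Cosets

section WordMetric

variable {G : Type*} [Group G]

theorem mulCayley_connected (S : Set G) (hS : Subgroup.closure S = ⊤) :
    (SimpleGraph.mulCayley S).Connected := by
  have step : ∀ (a b : G), (b ∈ S ∨ b⁻¹ ∈ S) → (SimpleGraph.mulCayley S).Reachable a (a * b) := by
    intro a b hb
    by_cases h : a = a * b
    · rw [← h]
    · apply SimpleGraph.Adj.reachable
      rw [SimpleGraph.mulCayley_adj']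
      refine ⟨h, ?_⟩
      rcases hb with hb | hb
      · exact ⟨b, hb, Or.inl rfl⟩
      · exact ⟨b⁻¹, hb, Or.inr (by simp)⟩
  have key : ∀ x ∈ Subgroup.closure S, ∀ a, (SimpleGraph.mulCayley S).Reachable a (a * x) := by
    intro x hx
    induction hx using Subgroup.closure_induction with
    | mem x hx => exact fun a => step a x (Or.inl hx)
    | one => intro a; simp
    | mul x y _ _ hx hy =>
      intro a
      have h := (hx a).trans (hy (a * x))
      rwa [mul_assoc] at h
    | inv x _ hx =>
      intro a
      have h := hx (a * x⁻¹)
      rw [inv_mul_cancel_right] at h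
      exact h.symm
  have : Nonempty G := ⟨1⟩
  refine ⟨fun a b => ?_⟩
  have h := key (a⁻¹ * b) (by rw [hS]; trivial) a
  rwa [mul_inv_cancel_left] at h

/-- The word metric on `G` associated to a generating set `S`, i.e. the path metric of the Cayley
graph: the distance between `g` and `h` is the least `n` such that `g⁻¹ * h` is a product of `n`
elements of `S ∪ S⁻¹`. -/
@[reducible]
noncomputable def wordMetric (S : Set G) (hS : Subgroup.closure S = ⊤) : MetricSpace G where
  dist g h := ((SimpleGraph.mulCayley S).dist g h : ℝ)
  dist_self g := by simp
  dist_comm g h := by rw [SimpleGraph.dist_comm]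
  dist_triangle g h k := by exact_mod_cast (mulCayley_connected S hS).dist_triangle
  eq_of_dist_eq_zero {g h} hgh :=
    (mulCayley_connected S hS).dist_eq_zero_iff.1 (by exact_mod_cast hgh)

end WordMetric

section QuasiRetract

variable {G H : Type*} [Group G] [Group H] {ι κ : Type*}

/-- `(f₁, f₂)` is an `(L, C, M)`-Lipschitz map of pairs `(G, P) → (H, Q)`, with respect to given
metrics on `G` and `H`. The Hausdorff distance takes values in `[0, ∞]`. -/
structure IsLipschitzMap [MetricSpace G] [MetricSpace H]
    (P : ι → Subgroup G) (Q : κ → Subgroup H) (L C M : ℝ)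
    (f₁ : G → H) (f₂ : Cosets P → Cosets Q) : Prop where
  lipschitz : ∀ x y : G, dist (f₁ x) (f₁ y) ≤ L * dist x y + C
  hausdorff_lt : ∀ A : Cosets P,
    Metric.hausdorffEDist (f₁ '' A.toSet) (f₂ A).toSet < ENNReal.ofReal M

/-- `((f₁, f₂), (r₁, r₂))` is an `(L, C, M)`-quasi-retraction of pairs. -/
structure IsQuasiRetraction [MetricSpace G] [MetricSpace H]
    (P : ι → Subgroup G) (Q : κ → Subgroup H) (L C M : ℝ)
    (f₁ : G → H) (f₂ : Cosets P → Cosets Q) (r₁ : H → G) (r₂ : Cosets Q → Cosets P) : Prop where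
  isLipschitzMap_f : IsLipschitzMap P Q L C M f₁ f₂
  isLipschitzMap_r : IsLipschitzMap Q P L C M r₁ r₂
  dist_le : ∀ g : G, dist (r₁ (f₁ g)) g ≤ C
  comp_eq_id : r₂ ∘ f₂ = id

/-- `(G, P)` is a quasi-retract of `(H, Q)`: for word metrics with respect to some finite
generating sets and some constants `L ≥ 1`, `C ≥ 0`, `M ≥ 0`, there is an
`(L, C, M)`-quasi-retraction of pairs. -/
def IsQuasiRetract (P : ι → Subgroup G) (Q : κ → Subgroup H) : Prop :=
  ∃ (S : Set G) (hS : Subgroup.closure S = ⊤) (T : Set H) (hT : Subgroup.closure T = ⊤),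
    S.Finite ∧ T.Finite ∧
    letI := wordMetric S hS
    letI := wordMetric T hT
    ∃ L C M : ℝ, 1 ≤ L ∧ 0 ≤ C ∧ 0 ≤ M ∧
      ∃ (f₁ : G → H) (f₂ : Cosets P → Cosets Q) (r₁ : H → G) (r₂ : Cosets Q → Cosets P),
        IsQuasiRetraction P Q L C M f₁ f₂ r₁ r₂

end QuasiRetract

end GroupPair

/-! Relative finite presentability is coarse simple connectedness of the coned-off Cayley graph,
tested here by nonabelian 1-cocycles: for every scale `E` there is a scale `D` such that cocycles at
scale `D`, with values in any group `K`, are coboundaries at scale `E`. If finitely many relators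
suffice, a cocycle at a large scale is trivial along each of them, so it can be integrated along
words (`IsRelFinitelyPresented.exists_isCoboundary`). Conversely, with `N` generated by the short
relations, the tautological cocycle with values in `F/N` is defined; a primitive of it forces `ker φ
≤ N` (`isRelFinitelyPresented_of_isCoboundary`). The criterion passes to quasi-retracts: a cocycle
on `G` is pulled back along `r` to `H`, trivialised there, and pulled back along `f`. Since `r₁ ∘
f₁` is close to the identity and `r₂ ∘ f₂ = id`, the result is cohomologous to the original cocycle.
The scale on `H` must not depend on `K`, because `N` is chosen after it. -/

namespace GroupPair

universe v

section RelFree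

variable {G : Type*} [Group G] {ι : Type*}

/-- The generator of `RelFree P S` given by an element of `S`. -/
def relGen (P : ι → Subgroup G) (S : Set G) (s : S) : RelFree P S :=
  Monoid.Coprod.inl (FreeGroup.of s)

/-- The inclusion of `P i` into `RelFree P S`. -/
def relIncl (P : ι → Subgroup G) (S : Set G) (i : ι) : P i →* RelFree P S :=
  Monoid.Coprod.inr.comp (Monoid.CoprodI.of (M := fun i => P i))

@[simp]
theorem relHom_relGen (P : ι → Subgroup G) (S : Set G) (s : S) :
    relHom P S (relGen P S s) = s := by
  simp [relHom, relGen]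

@[simp]
theorem relHom_relIncl (P : ι → Subgroup G) (S : Set G) (i : ι) (p : P i) :
    relHom P S (relIncl P S i p) = p := by
  simp [relHom, relIncl]

theorem RelFree.induction_on {P : ι → Subgroup G} {S : Set G} {motive : RelFree P S → Prop}
    (w : RelFree P S) (one : motive 1) (gen : ∀ s, motive (relGen P S s))
    (inv_gen : ∀ s, motive (relGen P S s)⁻¹) (incl : ∀ i p, motive (relIncl P S i p))
    (mul : ∀ v w, motive v → motive w → motive (v * w)) : motive w := by
  induction w using Monoid.Coprod.induction_on with
  | inl m =>
    induction m using FreeGroup.induction_on with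
    | C1 => simpa using one
    | of s => exact gen s
    | inv_of s _ => simpa [relGen] using inv_gen s
    | mul x y hx hy => simpa using mul _ _ hx hy
  | inr m =>
    induction m using Monoid.CoprodI.induction_on with
    | one => simpa using one
    | of i p => exact incl i p
    | mul x y hx hy => simpa using mul _ _ hx hy
  | mul x y hx hy => exact mul _ _ hx hy

end RelFree

/-! ### Left invariance and finite balls for word metrics. -/

section Metric

variable {G : Type*} [Group G]

theorem dist_mulCayley_mul_left (S : Set G) (hS : Subgroup.closure S = ⊤) (g x y : G) :
    (SimpleGraph.mulCayley S).dist (g * x) (g * y) = (SimpleGraph.mulCayley S).dist x y := by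
  have key : ∀ g x y : G,
      (SimpleGraph.mulCayley S).dist (g * x) (g * y) ≤ (SimpleGraph.mulCayley S).dist x y := by
    intro g x y
    obtain ⟨p, hp⟩ := (mulCayley_connected S hS).exists_walk_length_eq_dist x y
    let φ : SimpleGraph.mulCayley S →g SimpleGraph.mulCayley S :=
      ⟨fun z => g * z, fun h => SimpleGraph.mulCayley_adj_mul_iff_right.2 h⟩
    have h := SimpleGraph.dist_le (p.map φ)
    rwa [SimpleGraph.Walk.length_map, hp] at h
  refine le_antisymm (key g x y) ?_
  simpa using key g⁻¹ (g * x) (g * y)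

theorem finite_ball_mulCayley {S : Set G} (hS : S.Finite) (hS' : Subgroup.closure S = ⊤) (n : ℕ) :
    {x : G | (SimpleGraph.mulCayley S).dist 1 x ≤ n}.Finite := by
  have key : ∀ n : ℕ, {x : G | ∃ p : (SimpleGraph.mulCayley S).Walk 1 x, p.length = n}.Finite := by
    intro n
    induction n with
    | zero =>
      refine (Set.finite_singleton (1 : G)).subset ?_
      rintro x ⟨p, hp⟩
      exact (SimpleGraph.Walk.eq_of_length_eq_zero hp).symm
    | succ n ih =>
      refine ((ih.mul hS).union (ih.mul hS.inv)).subset ?_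
      rintro x ⟨p, hp⟩
      have hnn : ¬ p.Nil := by
        rw [← SimpleGraph.Walk.length_eq_zero_iff]; omega
      have hadj := p.adj_penultimate hnn
      have hmem : p.penultimate ∈
          {x : G | ∃ p : (SimpleGraph.mulCayley S).Walk 1 x, p.length = n} :=
        ⟨p.dropLast, by simp [hp]⟩
      rw [SimpleGraph.mulCayley_adj] at hadj
      rcases hadj.2 with h | h
      · exact Or.inl ⟨_, hmem, _, h, by simp⟩
      · exact Or.inr ⟨_, hmem, p.penultimate⁻¹ * x, by simpa using h, by simp⟩
  refine ((Set.finite_Iic n).biUnion fun m _ => key m).subset ?_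
  intro x hx
  obtain ⟨p, hp⟩ := (mulCayley_connected S hS').exists_walk_length_eq_dist 1 x
  exact Set.mem_biUnion (show p.length ∈ Set.Iic n by simpa [hp] using hx) ⟨p, rfl⟩

end Metric

/-! ### Nonabelian cocycles on the coned-off Rips complex. -/

section Cocycle

variable {G : Type*} [Group G] {ι : Type*} {K : Type*} [Group K]

/-- The point `x` lies at distance at most `D` from a point of the coset `A`. -/
def IsNear [MetricSpace G] {P : ι → Subgroup G} (D : ℝ) (x : G) (A : Cosets P) : Prop :=
  ∃ a ∈ A.toSet, dist x a ≤ D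

theorem IsNear.mono [MetricSpace G] {P : ι → Subgroup G} {D E : ℝ} (h : D ≤ E) {x : G}
    {A : Cosets P} (hx : IsNear D x A) : IsNear E x A :=
  let ⟨a, ha, hd⟩ := hx
  ⟨a, ha, hd.trans h⟩

theorem isNear_of_mem [MetricSpace G] {P : ι → Subgroup G} {D : ℝ} (hD : 0 ≤ D) {x : G}
    {A : Cosets P} (hx : x ∈ A.toSet) : IsNear D x A :=
  ⟨x, hx, by simpa using hD⟩

/-- A `K`-valued 1-cocycle, at scale `D`, on the coned-off Rips complex of the pair `(G, P)`: the
vertices are the points of `G` and the cosets in `G/P`, the value on an edge joining two points is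
given by `c`, and the value on an edge joining a point to a coset is given by `e`. -/
structure IsCocycle [MetricSpace G] (P : ι → Subgroup G) (D : ℝ) (c : G → G → K)
    (e : G → Cosets P → K) : Prop where
  mul : ∀ x y z, dist x y ≤ D → dist y z ≤ D → dist x z ≤ D → c x y * c y z = c x z
  cone : ∀ x y A, dist x y ≤ D → IsNear D x A → IsNear D y A → c x y * e y A = e x A

/-- `(c, e)` is, on the edges of length at most `D`, the coboundary of a function on vertices. -/
def IsCoboundary [MetricSpace G] (P : ι → Subgroup G) (D : ℝ) (c : G → G → K)
    (e : G → Cosets P → K) : Prop :=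
  ∃ (b : G → K) (b' : Cosets P → K), (∀ x y, dist x y ≤ D → c x y = (b x)⁻¹ * b y) ∧
    ∀ x A, IsNear D x A → e x A = (b x)⁻¹ * b' A

section

variable [MetricSpace G] {P : ι → Subgroup G} {D : ℝ} {c : G → G → K} {e : G → Cosets P → K}

theorem IsCocycle.self_eq_one (h : IsCocycle P D c e) (hD : 0 ≤ D) (x : G) : c x x = 1 := by
  have := h.mul x x x (by simpa) (by simpa) (by simpa)
  simpa using this

theorem IsCocycle.inv_eq (h : IsCocycle P D c e) (hD : 0 ≤ D) {x y : G} (hxy : dist x y ≤ D) :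
    (c x y)⁻¹ = c y x := by
  rw [inv_eq_iff_mul_eq_one, h.mul x y x hxy (by rwa [dist_comm]) (by simpa), h.self_eq_one hD]

end

/-! ### Holonomy along words. -/

/-- The action of `G` on functions on `G` by right translation. -/
def translateAut (G K : Type*) [Group G] [Group K] : G →* MulAut (G → K) where
  toFun g :=
    { toFun := fun f h => f (h * g)
      invFun := fun f h => f (h * g⁻¹)
      left_inv := fun f => by ext h; simp
      right_inv := fun f => by ext h; simp
      map_mul' := fun _ _ => rfl }
  map_one' := by ext f h; simp
  map_mul' g g' := by ext f h; simp [mul_assoc]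

@[simp]
theorem translateAut_apply (g : G) (f : G → K) (h : G) : translateAut G K g f h = f (h * g) := rfl

@[simp]
theorem translateAut_symm_apply (g : G) (f : G → K) (h : G) :
    (translateAut G K g).symm f h = f (h * g⁻¹) := rfl

/-- The homomorphism sending a word `w` to its image in `G` together with the function giving, for
each `h : G`, the product of the values of `(c, e)` along the path that starts at `h` and is
labelled by `w`. -/
def holonomy (P : ι → Subgroup G) (S : Set G) (c : G → G → K) (e : G → Cosets P → K) :
    RelFree P S →* (G → K) ⋊[translateAut G K] G :=
  Monoid.Coprod.lift (FreeGroup.lift fun s : S => ⟨fun h => c h (h * s), s⟩)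
    (Monoid.CoprodI.lift fun i =>
      -- The letter `p` is read as the detour from `h` to `h * p` through the cone vertex of their
      -- common coset. Such detours telescope, so this is a homomorphism without any cocycle
      -- condition.
      { toFun := fun p => ⟨fun h => e h ⟨i, h⟩ * (e (h * p) ⟨i, h⟩)⁻¹, p⟩
        map_one' := by
          ext
          · simp
          · rfl
        map_mul' := fun p q => by
          ext h
          · have : (QuotientGroup.mk (h * p) : G ⧸ P i) = QuotientGroup.mk h := by
              simp
            simp [this, mul_assoc]
          · simp })

section

variable (P : ι → Subgroup G) (S : Set G) (c : G → G → K) (e : G → Cosets P → K)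

theorem holonomy_relGen (s : S) :
    holonomy P S c e (relGen P S s) = ⟨fun h => c h (h * s), s⟩ := by
  simp [holonomy, relGen]

theorem holonomy_relIncl (i : ι) (p : P i) :
    holonomy P S c e (relIncl P S i p) =
      ⟨fun h => e h ⟨i, h⟩ * (e (h * p) ⟨i, h⟩)⁻¹, p⟩ := by
  simp [holonomy, relIncl]

theorem holonomy_right (w : RelFree P S) : (holonomy P S c e w).right = relHom P S w := by
  induction w using RelFree.induction_on with
  | one => simp
  | gen s => simp [holonomy_relGen]
  | inv_gen s => simp [holonomy_relGen]
  | incl i p => simp [holonomy_relIncl]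
  | mul v w hv hw => simp [hv, hw]

theorem holonomy_mul_left (v w : RelFree P S) (h : G) :
    (holonomy P S c e (v * w)).left h =
      (holonomy P S c e v).left h * (holonomy P S c e w).left (h * relHom P S v) := by
  simp [holonomy_right]

end

theorem mk_mul_mem {P : ι → Subgroup G} {i : ι} (h : G) (p : P i) :
    (h * p : G) ∈ Cosets.toSet (P := P) ⟨i, h⟩ := by
  simp [Cosets.toSet]

theorem self_mem_mk {P : ι → Subgroup G} {i : ι} (h : G) :
    h ∈ Cosets.toSet (P := P) ⟨i, h⟩ := rfl

variable [MetricSpace G]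

/-- At large scales, the value of a cocycle along a path with a given label depends only on the
endpoints. -/
theorem exists_holonomy_eq (hinv : ∀ g x y : G, dist (g * x) (g * y) = dist x y)
    (P : ι → Subgroup G) (S : Set G) (w : RelFree P S) :
    ∃ N : ℝ, ∀ D, N ≤ D → ∀ (K : Type v) [Group K] (c : G → G → K) (e : G → Cosets P → K), IsCocycle P D c e →
      ∀ h, (holonomy P S c e w).left h = c h (h * relHom P S w) := by
  have hdist (h g : G) : dist h (h * g) = dist 1 g := by
    simpa using hinv h 1 g
  induction w using RelFree.induction_on with
  | one =>
    refine ⟨0, fun D hD K _ c e hc h => ?_⟩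
    simp [hc.self_eq_one hD]
  | gen s => exact ⟨0, fun D hD K _ c e hc h => by simp [holonomy_relGen]⟩
  | inv_gen s =>
    refine ⟨dist 1 (s : G), fun D hD K _ c e hc h => ?_⟩
    have := hc.inv_eq (dist_nonneg.trans hD) (x := h * (s : G)⁻¹) (y := h)
      (by simpa using (hdist (h * (s : G)⁻¹) s).trans_le hD)
    simp [holonomy_relGen, this]
  | incl i p =>
    refine ⟨dist 1 (p : G), fun D hD K _ c e hc h => ?_⟩
    have hD0 := dist_nonneg.trans hD
    have := hc.cone h (h * p) ⟨i, h⟩ ((hdist _ _).trans_le hD) (isNear_of_mem hD0 (self_mem_mk h))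
      (isNear_of_mem hD0 (mk_mul_mem h p))
    simp [holonomy_relIncl, ← this]
  | mul v w hv hw =>
    obtain ⟨N, hN⟩ := hv
    obtain ⟨N', hN'⟩ := hw
    -- The last three terms bound the sides of the triangle spanned by `h` and its translates by `v`
    -- and `v * w`.
    refine ⟨max (max N N') (max (dist 1 (relHom P S v)) (max (dist 1 (relHom P S w))
      (dist 1 (relHom P S (v * w))))), fun D hD K _ c e hc h => ?_⟩
    simp only [max_le_iff] at hD
    obtain ⟨⟨h1, h2⟩, h3, h4, h5⟩ := hD
    rw [holonomy_mul_left, hN D h1 K c e hc, hN' D h2 K c e hc,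
      hc.mul _ _ _ ((hdist _ _).trans_le h3) ((hdist _ _).trans_le h4)
        (by rw [mul_assoc, ← map_mul]; exact (hdist _ _).trans_le h5), mul_assoc, map_mul]

theorem exists_forall_mem_le_of_finite {α : Type*} {s : Set α} (hs : s.Finite) (f : α → ℝ) :
    ∃ N, ∀ x ∈ s, f x ≤ N := by
  obtain ⟨N, hN⟩ := (hs.image f).bddAbove
  exact ⟨N, fun x hx => hN ⟨x, hx, rfl⟩⟩

/-! ### From finite presentations to coboundaries. -/

/-- If `(G, P)` is relatively finitely presented then large-scale cocycles are coboundaries. -/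
theorem IsRelFinitelyPresented.exists_isCoboundary {P : ι → Subgroup G}
    (hP : IsRelFinitelyPresented P) (hinv : ∀ g x y : G, dist (g * x) (g * y) = dist x y)
    (hfin : ∀ r : ℝ, {x : G | dist 1 x ≤ r}.Finite) (E : ℝ) (hE : 0 ≤ E) :
    ∃ D, 0 ≤ D ∧ ∀ (K : Type v) [Group K] (c : G → G → K) (e : G → Cosets P → K), IsCocycle P D c e →
      IsCoboundary P E c e := by
  obtain ⟨S, R, -, hR, hgen, hker⟩ := hP
  choose σ hσ using hgen
  choose N hN using exists_holonomy_eq.{v} hinv P S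
  obtain ⟨D₁, hD₁⟩ := exists_forall_mem_le_of_finite hR N
  obtain ⟨D₂, hD₂⟩ := exists_forall_mem_le_of_finite (hfin E) (fun x => N (σ x))
  refine ⟨max E (max D₁ D₂), le_max_of_le_left hE, fun K _ c e hc => ?_⟩
  set D := max E (max D₁ D₂)
  have hED : E ≤ D := le_max_left _ _
  have hD : 0 ≤ D := hE.trans hED
  -- Relators label loops, where the holonomy is `c h h = 1`; hence holonomy depends only on the
  -- image of the word in `G`.
  have hkerle : (relHom P S).ker ≤ (holonomy P S c e).ker := by
    rw [← hker]
    refine Subgroup.normalClosure_le_normal fun r hr => ?_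
    have hr1 : relHom P S r = 1 := by
      rw [← MonoidHom.mem_ker, ← hker]
      exact Subgroup.subset_normalClosure hr
    change holonomy P S c e r = 1
    ext h
    · rw [hN r D ((hD₁ r hr).trans (by simp [D])) K c e hc, hr1, mul_one, hc.self_eq_one hD]
      rfl
    · rw [holonomy_right, hr1]
      rfl
  -- The primitive: integration from `1` to `x` along any word representing `x`.
  set b : G → K := fun x => (holonomy P S c e (σ x)).left 1 with hb
  have hbw : ∀ w, (holonomy P S c e w).left 1 = b (relHom P S w) := by
    intro w
    have hmem : (σ (relHom P S w))⁻¹ * w ∈ (relHom P S).ker := by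
      simp [MonoidHom.mem_ker, hσ]
    have := hkerle hmem
    rw [MonoidHom.mem_ker, map_mul, map_inv, inv_mul_eq_one] at this
    simp only [hb, this]
  have hstep : ∀ w h, (holonomy P S c e w).left h = (b h)⁻¹ * b (h * relHom P S w) := by
    intro w h
    have := holonomy_mul_left P S c e (σ h) w 1
    rw [hbw, hbw, one_mul, map_mul, hσ] at this
    rw [this, inv_mul_cancel_left]
  have hcb : ∀ x y, dist x y ≤ E → c x y = (b x)⁻¹ * b y := by
    intro x y hxy
    have hmem : dist 1 (x⁻¹ * y) ≤ E := by
      rwa [← hinv x, mul_one, mul_inv_cancel_left]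
    have h1 := hN (σ (x⁻¹ * y)) D ((hD₂ _ hmem).trans (by simp [D])) K c e hc x
    rw [hstep, hσ, mul_inv_cancel_left] at h1
    exact h1.symm
  have hcone : ∀ (A : Cosets P) (a a' : G), a ∈ A.toSet → a' ∈ A.toSet →
      b a * e a A = b a' * e a' A := by
    rintro ⟨i, q⟩ a a' ha ha'
    obtain rfl : (a : G ⧸ P i) = q := ha
    have hp : a⁻¹ * a' ∈ P i := QuotientGroup.eq.1 (Eq.symm ha')
    have h1 := hstep (relIncl P S i ⟨_, hp⟩) a
    simp only [holonomy_relIncl, relHom_relIncl, mul_inv_cancel_left] at h1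
    rw [eq_inv_mul_iff_mul_eq, ← mul_assoc, mul_inv_eq_iff_eq_mul] at h1
    exact h1
  -- By `hcone`, the value at a cone vertex may be read off from any point of the coset.
  refine ⟨b, fun A => b A.2.out * e A.2.out A, hcb, ?_⟩
  rintro x A ⟨a, ha, hxa⟩
  have h1 := hcone A a A.2.out ha (by simp [Cosets.toSet])
  change e x A = (b x)⁻¹ * (b A.2.out * e A.2.out A)
  rw [← h1, ← mul_assoc, ← hcb x a hxa]
  exact (hc.cone x a A (hxa.trans hED) ⟨a, ha, hxa.trans hED⟩ (isNear_of_mem hD ha)).symm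

/-! ### From coboundaries to finite presentations. -/

/-- If large-scale cocycles with values in suitable quotients of `RelFree P T` are coboundaries at
a scale at which the finite generating set `T` is visible, then `(G, P)` is relatively finitely
presented. -/
theorem isRelFinitelyPresented_of_isCoboundary [Finite ι] {P : ι → Subgroup G}
    (hinv : ∀ g x y : G, dist (g * x) (g * y) = dist x y)
    (hfin : ∀ r : ℝ, {x : G | dist 1 x ≤ r}.Finite)
    {T : Set G} (hT : T.Finite) (hTgen : Subgroup.closure T = ⊤) {D E : ℝ} (hD : 0 ≤ D) (hE : 0 ≤ E)
    (hTE : ∀ t ∈ T, dist 1 t ≤ E)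
    (H : ∀ (N : Subgroup (RelFree P T)) [N.Normal] (c : G → G → RelFree P T ⧸ N)
      (e : G → Cosets P → RelFree P T ⧸ N), IsCocycle P D c e → IsCoboundary P E c e) :
    IsRelFinitelyPresented P := by
  have hsurj : Function.Surjective (relHom P T) := by
    rw [← MonoidHom.range_eq_top, eq_top_iff, ← hTgen, Subgroup.closure_le]
    exact fun t ht => ⟨relGen P T ⟨t, ht⟩, relHom_relGen P T ⟨t, ht⟩⟩
  choose σ hσ using hsurj
  -- Radius `3 * D`: if `x`, `y` are `D`-close and `a`, `a'` are points of one coset within `D` of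
  -- `x`, `y` respectively, then `a` and `a'` are up to `3 * D` apart.
  set B : Set G := {x : G | dist 1 x ≤ 3 * D}
  have hBfin : B.Finite := hfin _
  -- The multiplication table of `B`, together with the identification of the chosen words `σ` with
  -- the letters from `P i ∩ B` and from `T`.
  set R : Set (RelFree P T) :=
    ((fun x : G × G => σ x.1 * σ x.2 * (σ (x.1 * x.2))⁻¹) '' (B ×ˢ B)) ∪
      ((⋃ i, (fun p : P i => (σ p)⁻¹ * relIncl P T i p) '' {p | (p : G) ∈ B}) ∪
      Set.range fun t : T => (σ t)⁻¹ * relGen P T t)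
  have hRfin : R.Finite := by
    refine ((hBfin.prod hBfin).image _).union (.union (Set.finite_iUnion fun i => ?_) ?_)
    · exact (hBfin.preimage Subtype.val_injective.injOn).image _
    · have := hT.to_subtype
      exact Set.finite_range _
  have hRker : R ⊆ (relHom P T).ker := by
    rintro r (⟨⟨x, y⟩, -, rfl⟩ | hr | ⟨t, rfl⟩)
    · simp [MonoidHom.mem_ker, hσ]
    · obtain ⟨i, p, -, rfl⟩ := Set.mem_iUnion.1 hr
      simp [MonoidHom.mem_ker, hσ]
    · simp [MonoidHom.mem_ker, hσ]
  refine ⟨T, R, hT, hRfin, fun x => ⟨σ x, hσ x⟩,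
    (Subgroup.normalClosure_le_normal hRker).antisymm ?_⟩
  set N := Subgroup.normalClosure R
  let π : RelFree P T →* RelFree P T ⧸ N := QuotientGroup.mk' N
  have hπR : ∀ r ∈ R, π r = 1 := fun r hr =>
    (QuotientGroup.eq_one_iff r).2 (Subgroup.subset_normalClosure hr)
  have hπmul : ∀ x ∈ B, ∀ y ∈ B, π (σ x) * π (σ y) = π (σ (x * y)) := by
    intro x hx y hy
    have := hπR _ (Or.inl ⟨(x, y), ⟨hx, hy⟩, rfl⟩)
    simpa [mul_inv_eq_one] using this
  have hπincl : ∀ i (p : P i), (p : G) ∈ B → π (σ p) = π (relIncl P T i p) := by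
    intro i p hp
    have := hπR _ (Or.inr (Or.inl (Set.mem_iUnion.2 ⟨i, p, hp, rfl⟩)))
    simpa [inv_mul_eq_one] using this
  have hπgen : ∀ t : T, π (σ t) = π (relGen P T t) := by
    intro t
    have := hπR _ (Or.inr (Or.inr ⟨t, rfl⟩))
    simpa [inv_mul_eq_one] using this
  have hmemB : ∀ x y : G, dist x y ≤ 3 * D → x⁻¹ * y ∈ B := by
    intro x y hxy
    change dist 1 (x⁻¹ * y) ≤ 3 * D
    rwa [← hinv x, mul_one, mul_inv_cancel_left]
  have hmulσ : ∀ x y z : G, dist x y ≤ 3 * D → dist y z ≤ 3 * D →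
      π (σ (x⁻¹ * y)) * π (σ (y⁻¹ * z)) = π (σ (x⁻¹ * z)) := by
    intro x y z hxy hyz
    rw [hπmul _ (hmemB x y hxy) _ (hmemB y z hyz)]
    simp [mul_assoc]
  have hmem : ∀ (A : Cosets P) (a : G), a ∈ A.toSet → a⁻¹ * A.2.out ∈ P A.1 := by
    intro A a ha
    rw [← QuotientGroup.eq, QuotientGroup.out_eq']
    exact ha
  have hmem2 : ∀ (A : Cosets P) (a a' : G), a ∈ A.toSet → a' ∈ A.toSet → a⁻¹ * a' ∈ P A.1 :=
    fun A a a' ha ha' => QuotientGroup.eq.1 (Eq.trans ha (Eq.symm ha'))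
  have hvia : ∀ (x : G) (A : Cosets P) (a a' : G) (ha : a ∈ A.toSet) (ha' : a' ∈ A.toSet),
      dist x a ≤ 3 * D → dist a a' ≤ 3 * D →
      π (σ (x⁻¹ * a)) * π (relIncl P T A.1 ⟨_, hmem A a ha⟩) =
        π (σ (x⁻¹ * a')) * π (relIncl P T A.1 ⟨_, hmem A a' ha'⟩) := by
    intro x A a a' ha ha' hxa haa'
    have h1 := hπincl A.1 ⟨_, hmem2 A a a' ha ha'⟩ (hmemB a a' haa')
    rw [← hmulσ x a a' hxa haa', h1, mul_assoc]
    congr 1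
    rw [← map_mul π, ← map_mul (relIncl P T A.1)]
    congr 2
    ext
    simp [mul_assoc]
  classical
  let c : G → G → RelFree P T ⧸ N := fun x y => π (σ (x⁻¹ * y))
  -- The path from `x` to a nearby point of `A`, then inside `A` to its representative. By `hvia`
  -- the choice of point is immaterial; the value `1` is never tested.
  let e : G → Cosets P → RelFree P T ⧸ N := fun x A =>
    if h : IsNear D x A then
      π (σ (x⁻¹ * h.choose)) * π (relIncl P T A.1 ⟨_, hmem A h.choose h.choose_spec.1⟩) else 1
  have he : ∀ (x : G) (A : Cosets P) (a : G) (ha : a ∈ A.toSet), dist x a ≤ D →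
      e x A = π (σ (x⁻¹ * a)) * π (relIncl P T A.1 ⟨_, hmem A a ha⟩) := by
    intro x A a ha hxa
    have h : IsNear D x A := ⟨a, ha, hxa⟩
    simp only [e, dif_pos h]
    have h1 := h.choose_spec.2
    refine hvia x A _ a h.choose_spec.1 ha (h1.trans (by linarith)) ?_
    have := dist_triangle_left h.choose a x
    linarith
  have hce : IsCocycle P D c e := by
    refine ⟨fun x y z hxy hyz _ => ?_, ?_⟩
    · exact hmulσ x y z (by linarith) (by linarith)
    · rintro x y A hxy ⟨a, ha, hxa⟩ ⟨a', ha', hya'⟩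
      have h1 := dist_triangle x y a'
      have h2 := dist_triangle_left a a' x
      rw [he x A a ha hxa, he y A a' ha' hya', ← mul_assoc,
        hmulσ x y a' (by linarith) (by linarith)]
      exact (hvia x A a a' ha ha' (by linarith) (by linarith)).symm
  obtain ⟨b, b', hb, hb'⟩ := H N c e hce
  have hσ1 : π (σ 1) = 1 := by
    have := hmulσ 1 1 1 (by simpa) (by simpa)
    simpa using this
  have hgen : ∀ (t : T) (g : G), b (g * t) = b g * π (relGen P T t) := by
    intro t g
    have h1 := hb g (g * t) ((by simpa using hinv g 1 t : dist g (g * t) = _).trans_le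
      (hTE t t.2))
    simp only [c, inv_mul_cancel_left, hπgen] at h1
    rw [h1, mul_inv_cancel_left]
  have hcoset : ∀ (A : Cosets P) (a : G) (ha : a ∈ A.toSet),
      b a * π (relIncl P T A.1 ⟨_, hmem A a ha⟩) = b' A := by
    intro A a ha
    have h1 := hb' a A (isNear_of_mem hE ha)
    rw [he a A a ha (by simpa), inv_mul_cancel, hσ1, one_mul] at h1
    rw [h1, mul_inv_cancel_left]
  -- The primitive `b` turns right translation by the image of `w` into multiplication by `π w`, so
  -- `w` in the kernel gives `π w = 1`.
  have hstep : ∀ (w : RelFree P T) (g : G), b (g * relHom P T w) = b g * π w := by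
    intro w
    induction w using RelFree.induction_on with
    | one => simp
    | gen t => simpa using hgen t
    | inv_gen t =>
      intro g
      have := hgen t (g * (t : G)⁻¹)
      rw [inv_mul_cancel_right] at this
      rw [this]
      simp
    | incl i p =>
      intro g
      -- Comparing `g` and `g * p` through their common cone vertex needs no bound on the length of
      -- `p`.
      have h1 := hcoset ⟨i, g⟩ g (self_mem_mk g)
      rw [← hcoset ⟨i, g⟩ (g * p) (mk_mul_mem g p)] at h1
      rw [relHom_relIncl, ← mul_right_cancel_iff, ← h1, mul_assoc]
      congr 1
      rw [← map_mul π, ← map_mul (relIncl P T i)]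
      congr 2
      ext
      simp [mul_assoc]
    | mul v w hv hw => intro g; rw [map_mul, ← mul_assoc, hw, hv, map_mul, mul_assoc]
  intro v hv
  have h1 := hstep v 1
  rw [MonoidHom.mem_ker.1 hv, mul_one, left_eq_mul] at h1
  exact (QuotientGroup.eq_one_iff v).1 h1

end Cocycle

/-! ### Functoriality under Lipschitz maps and invariance under bounded perturbation. -/

section QuasiRetract

variable {G H : Type*} [Group G] [Group H] [MetricSpace G] [MetricSpace H] {ι κ : Type*}
  {P : ι → Subgroup G} {Q : κ → Subgroup H} {K : Type*} [Group K]

theorem IsLipschitzMap.exists_dist_lt {L C M : ℝ} {f₁ : G → H} {f₂ : Cosets P → Cosets Q}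
    (hf : IsLipschitzMap P Q L C M f₁ f₂) {A : Cosets P} {a : G} (ha : a ∈ A.toSet) :
    ∃ b ∈ (f₂ A).toSet, dist (f₁ a) b < M := by
  obtain ⟨b, hb, h⟩ := Metric.exists_edist_lt_of_hausdorffEDist_lt
    (Set.mem_image_of_mem f₁ ha) (hf.hausdorff_lt A)
  exact ⟨b, hb, edist_lt_ofReal.1 h⟩

theorem IsLipschitzMap.dist_le_of_le {L C M : ℝ} {f₁ : G → H} {f₂ : Cosets P → Cosets Q}
    (hf : IsLipschitzMap P Q L C M f₁ f₂) (hL : 0 ≤ L) {x y : G} {D : ℝ} (h : dist x y ≤ D) :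
    dist (f₁ x) (f₁ y) ≤ L * D + C :=
  (hf.lipschitz x y).trans (by gcongr)

theorem IsLipschitzMap.isNear {L C M : ℝ} {f₁ : G → H} {f₂ : Cosets P → Cosets Q}
    (hf : IsLipschitzMap P Q L C M f₁ f₂) (hL : 0 ≤ L) {x : G} {A : Cosets P} {D : ℝ}
    (h : IsNear D x A) : IsNear (L * D + C + M) (f₁ x) (f₂ A) := by
  obtain ⟨a, ha, hxa⟩ := h
  obtain ⟨b, hb, hab⟩ := hf.exists_dist_lt ha
  exact ⟨b, hb, (dist_triangle _ _ _).trans (add_le_add (hf.dist_le_of_le hL hxa) hab.le)⟩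

/-- Cocycles pull back along Lipschitz maps of pairs. -/
theorem IsCocycle.comp {L C M D E : ℝ} {f₁ : G → H} {f₂ : Cosets P → Cosets Q} {c : H → H → K}
    {e : H → Cosets Q → K} (hc : IsCocycle Q E c e) (hf : IsLipschitzMap P Q L C M f₁ f₂)
    (hL : 0 ≤ L) (hM : 0 ≤ M) (hE : L * D + C + M ≤ E) :
    IsCocycle P D (fun x y => c (f₁ x) (f₁ y)) (fun x A => e (f₁ x) (f₂ A)) := by
  have hd : ∀ x y, dist x y ≤ D → dist (f₁ x) (f₁ y) ≤ E := fun x y h =>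
    (hf.dist_le_of_le hL h).trans (by linarith)
  exact ⟨fun x y z hxy hyz hxz => hc.mul _ _ _ (hd _ _ hxy) (hd _ _ hyz) (hd _ _ hxz),
    fun x y A hxy hx hy => hc.cone _ _ _ (hd _ _ hxy) ((hf.isNear hL hx).mono hE)
      ((hf.isNear hL hy).mono hE)⟩

/-- Coboundaries pull back along Lipschitz maps of pairs. -/
theorem IsCoboundary.comp {L C M D E : ℝ} {f₁ : G → H} {f₂ : Cosets P → Cosets Q}
    {c : H → H → K} {e : H → Cosets Q → K} (hc : IsCoboundary Q E c e)
    (hf : IsLipschitzMap P Q L C M f₁ f₂) (hL : 0 ≤ L) (hM : 0 ≤ M) (hE : L * D + C + M ≤ E) :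
    IsCoboundary P D (fun x y => c (f₁ x) (f₁ y)) (fun x A => e (f₁ x) (f₂ A)) := by
  obtain ⟨b, b', hb, hb'⟩ := hc
  exact ⟨fun x => b (f₁ x), fun A => b' (f₂ A),
    fun x y h => hb _ _ ((hf.dist_le_of_le hL h).trans (by linarith)),
    fun x A h => hb' _ _ ((hf.isNear hL h).mono hE)⟩

/-- The pull-back of a cocycle along a self-map at bounded distance from the identity is
cohomologous to the cocycle. -/
theorem IsCocycle.isCoboundary_of_comp {C D E : ℝ} {s : G → G} {c : G → G → K}
    {e : G → Cosets P → K} (hc : IsCocycle P D c e) (hC : 0 ≤ C) (hE : 0 ≤ E) (hCE : C + E ≤ D)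
    (hs : ∀ g, dist (s g) g ≤ C) (hsD : ∀ x y, dist x y ≤ E → dist (s x) (s y) ≤ D)
    (h : IsCoboundary P E (fun x y => c (s x) (s y)) (fun x A => e (s x) A)) :
    IsCoboundary P E c e := by
  obtain ⟨b, b', hb, hb'⟩ := h
  beta_reduce at hb hb'
  have hsy : ∀ x y, dist x y ≤ E → dist (s x) y ≤ D := fun x y hxy =>
    (dist_triangle _ x _).trans ((add_le_add (hs x) hxy).trans hCE)
  -- The primitive is corrected along the short edge from `s x` to `x`. The square on `x`, `y`, `s
  -- x`, `s y` splits into two triangles along the diagonal from `s x` to `y`; cone vertices do not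
  -- move.
  refine ⟨fun x => b x * c (s x) x, b', fun x y hxy => ?_, fun x A hx => ?_⟩
  · have h1 := hb x y hxy
    have h2 := hc.mul (s x) x y (hsy _ _ (by simpa)) (by linarith) (hsy _ _ hxy)
    have h3 := hc.mul (s x) (s y) y (hsD _ _ hxy) (hsy _ _ (by simpa)) (hsy _ _ hxy)
    rw [← h3, h1] at h2
    beta_reduce
    rw [eq_inv_mul_iff_mul_eq, mul_assoc, h2]
    simp [mul_assoc]
  · have hnear : IsNear D (s x) A := by
      obtain ⟨a, ha, hxa⟩ := hx
      exact ⟨a, ha, hsy _ _ hxa⟩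
    have h1 := hc.cone (s x) x A (hsy _ _ (by simpa)) hnear (hx.mono (by linarith))
    rw [hb' x A hx] at h1
    beta_reduce
    rw [eq_inv_mul_iff_mul_eq, mul_assoc, h1, mul_inv_cancel_left]

end QuasiRetract

theorem finite_ball_wordMetric {G : Type*} [Group G] {S : Set G} (hS : S.Finite)
    (hS' : Subgroup.closure S = ⊤) (r : ℝ) :
    {x : G | (wordMetric S hS').dist 1 x ≤ r}.Finite := by
  obtain ⟨n, hn⟩ := exists_nat_ge r
  refine (finite_ball_mulCayley hS hS' n).subset fun x hx => ?_
  have : ((SimpleGraph.mulCayley S).dist 1 x : ℝ) ≤ n := le_trans hx hn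
  exact_mod_cast this

theorem wordMetric_dist_mul_left {G : Type*} [Group G] {S : Set G}
    (hS : Subgroup.closure S = ⊤) (g x y : G) :
    (wordMetric S hS).dist (g * x) (g * y) = (wordMetric S hS).dist x y :=
  congrArg Nat.cast (dist_mulCayley_mul_left S hS g x y)

theorem IsQuasiRetract.isRelFinitelyPresented {G H : Type*} [Group G] [Group H] {ι κ : Type*}
    [Finite ι] {P : ι → Subgroup G} {Q : κ → Subgroup H} (hGH : IsQuasiRetract P Q)
    (hH : IsRelFinitelyPresented Q) : IsRelFinitelyPresented P := by
  obtain ⟨S, hS, T, hT, hSfin, hTfin, L, C, M, hL, hC, hM, f₁, f₂, r₁, r₂, h⟩ := hGH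
  let _ := wordMetric S hS
  let _ := wordMetric T hT
  have hL0 : 0 ≤ L := zero_le_one.trans hL
  obtain ⟨E₀, hE₀⟩ := exists_forall_mem_le_of_finite hSfin (fun x => dist 1 x)
  set E := max E₀ 0
  have hE : 0 ≤ E := le_max_right _ _
  have hLE : 0 ≤ L * E := mul_nonneg hL0 hE
  obtain ⟨D, hD, key⟩ := hH.exists_isCoboundary (wordMetric_dist_mul_left hT)
    (finite_ball_wordMetric hTfin hT) (L * E + C + M) (by linarith)
  have hLD : 0 ≤ L * D := mul_nonneg hL0 hD
  have hLLE : 0 ≤ L * (L * E + C) := mul_nonneg hL0 (by linarith)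
  refine isRelFinitelyPresented_of_isCoboundary (wordMetric_dist_mul_left hS)
    (finite_ball_wordMetric hSfin hS) hSfin hS
    -- The summands serve, in order, the pull-back along `r`, the diagonals from `r₁ (f₁ x)` to `y`,
    -- and the distance from `r₁ (f₁ x)` to `r₁ (f₁ y)`.
    (D := (L * D + C + M) + (C + E) + (L * (L * E + C) + C)) (E := E) (by linarith) hE
    (fun t ht => (hE₀ t ht).trans (le_max_left _ _)) fun N _ c e hc => ?_
  have h1 := (key _ _ _ (hc.comp (D := D) h.isLipschitzMap_r hL0 hM (by linarith))).comp
    (D := E) h.isLipschitzMap_f hL0 hM le_rfl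
  have hid : ∀ A, r₂ (f₂ A) = A := congrFun h.comp_eq_id
  simp only [hid] at h1
  refine hc.isCoboundary_of_comp (s := r₁ ∘ f₁) hC hE (by linarith) h.dist_le
    (fun x y hxy => ?_) h1
  exact (h.isLipschitzMap_r.dist_le_of_le hL0
    (h.isLipschitzMap_f.dist_le_of_le hL0 hxy)).trans (by linarith)

end GroupPair

theorem mainTheorem2 {G H : Type*} [Group G] [Group H] [Group.FG G] [Group.FG H]
    {ι κ : Type*} [Finite ι] [Nonempty ι] [Finite κ] [Nonempty κ]
    (P : ι → Subgroup G) (Q : κ → Subgroup H)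
    (hGH : GroupPair.IsQuasiRetract P Q) (hH : GroupPair.IsRelFinitelyPresented Q) :
    GroupPair.IsRelFinitelyPresented P :=
  hGH.isRelFinitelyPresented hH
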